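/- Let $\mathbb{X}$ be a semi-abelian category, that is, a pointed, Barr exact and Bourn protomodular category with finite coproducts. Two morphisms $x\colon X\to D$ and $y\colon Y\to D$ of a pointed category with binary products \emph{Huq-commute} when there is a morphism $\varphi\colon X\times Y\to D$ with $\varphi\circ\langle 1_X,0\rangle=x$ and $\varphi\circ\langle 0,1_Y\rangle=y$. For an object $B$ of $\mathbb{X}$, let $\mathsf{Pt}_B(\mathbb{X})$ be the (pointed) category of points over $B$: its objects are the split epimorphisms with codomain $B$ together with a chosen section, and its morphisms are the morphisms over $B$ compatible with the sections. We say that $\mathbb{X}$ satisfies (SSH) when for every morphism $p\colon E\to B$ in $\mathbb{X}$ the pullback functor $p^{*}\colon\mathsf{Pt}_B(\mathbb{X})\to\mathsf{Pt}_E(\mathbb{X})$ reflects Huq-commutation: for any two morphisms $\alpha$, $\gamma$ in $\mathsf{Pt}_B(\mathbb{X})$ with the same codomain, if $p^{*}(\alpha)$ and $p^{*}(\gamma)$ Huq-commute, then so do $\alpha$ and $\gamma$. A \emph{weighted cospan} $(x,y,w)$ in $\mathbb{X}$ consists of morphisms $x\colon X\to D$, $y\colon Y\to D$ and $w\colon W\to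 D$. Write $\iota_W$ for the coproduct inclusions $W\to W+X$ and $W\to W+Y$, and $[u,v]$ for the morphism on a coproduct induced by $u$ and $v$. The morphisms $x$ and $y$ \emph{commute over} $w$ when there is a morphism $\varphi\colon (W+X)\times_W(W+Y)\to D$, where the pullback is that of $[1_W,0]\colon W+X\to W$ and $[1_W,0]\colon W+Y\to W$, such that $\varphi\circ\langle 1_{W+X},\iota_W\circ[1_W,0]\rangle=[w,x]$ and $\varphi\circ\langle\iota_W\circ[1_W,0],1_{W+Y}\rangle=[w,y]$. For subobjects $K$, $L$, $M$ of $D$, the \emph{Higgins commutator} $[K,L]\leq D$ is the image of the composite $\mathrm{Ker}(K+L\to K\times L)\to K+L\to D$, and the \emph{ternary Higgins commutator} $[K,L,M]\leq D$ is the image of the composite $\mathrm{Ker}\bigl(K+L+M\to(K+L)\times(K+M)\times(L+M)\bigr)\to K+L+M\to D$. Here the morphisms to $D$ are induced by the inclusions of the subobjects, and the other morphisms on the coproducts are the canonical ones: each component sends a summand that occurs in its codomain by the inclusion and the other summand to $0$. Given $w\colon W\to D$, the cospan $(x,y)$ is \emph{$w$-proper} when $[\mathrm{Im}(w),\mathrm{Im}(x)]\leq\mathrm{Im}(x)$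 and $[\mathrm{Im}(w),\mathrm{Im}(y)]\leq\mathrm{Im}(y)$. The following conditions are equivalent: \begin{enumerate} \item[(i)] $\mathbb{X}$ satisfies (SSH); \item[(ii)] for any weighted cospan $(x,y,w)$ such that $(x,y)$ is $w$-proper, if $x$ and $y$ Huq-commute, then they commute over $w$; \item[(iii)] for any cospan $(x,y)$, the property of commuting over $w$ is independent of the chosen weight $w$ for which $(x,y)$ is $w$-proper: if $(x,y)$ is both $w$-proper and $w'$-proper, for weights $w\colon W\to D$ and $w'\colon W'\to D$, then $x$ and $y$ commute over $w$ if and only if they commute over $w'$; \item[(iv)] for any weighted cospan $(x,y,w)$ such that $(x,y)$ is $w$-proper, if $[\mathrm{Im}(x),\mathrm{Im}(y)]=0$, then $[\mathrm{Im}(x),\mathrm{Im}(y),\mathrm{Im}(w)]=0$. \end{enumerate} -/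

import Mathlib

open CategoryTheory CategoryTheory.Limits

universe v u

-- morphisms `X ⟶ Y` are to be read through `CategoryStruct.toQuiver`
attribute [-instance] catToReflQuiver

noncomputable section

namespace SemiAb

variable {C : Type u} [Category.{v} C]

/-! ### The category of points over an object -/

/-- A point over `B`: a split epimorphism `π : obj ⟶ B` with a chosen section `σ`. -/
structure Point (B : C) where
  obj : C
  π : obj ⟶ B
  σ : B ⟶ obj
  σ_π : σ ≫ π = 𝟙 B

namespace Point

attribute [simp] σ_π

variable {B : C}

/-- A morphism of points over `B`: compatible with the split epimorphisms and the sections. -/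
@[ext]
structure Hom (P Q : Point B) where
  hom : P.obj ⟶ Q.obj
  hom_π : hom ≫ Q.π = P.π
  σ_hom : P.σ ≫ hom = Q.σ

attribute [simp] Hom.hom_π Hom.σ_hom

/-- The category `Pt_B(C)` of points over `B`. -/
instance : Category (Point B) where
  Hom P Q := Hom P Q
  id P := ⟨𝟙 P.obj, by simp, by simp⟩
  comp f g := ⟨f.hom ≫ g.hom, by simp, by simp [← Category.assoc]⟩

@[simp] lemma id_hom (P : Point B) : Hom.hom (𝟙 P) = 𝟙 P.obj := rfl

@[simp] lemma comp_hom {P Q R : Point B} (f : P ⟶ Q) (g : Q ⟶ R) :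
    (f ≫ g).hom = f.hom ≫ g.hom := rfl

@[ext] lemma hom_ext {P Q : Point B} {f g : P ⟶ Q} (h : f.hom = g.hom) : f = g :=
  Hom.ext h

/-- `Pt_B(C)` is pointed, the zero object being `(B, 1_B, 1_B)`; the zero morphism
`P ⟶ Q` is `σ_Q ∘ π_P`. -/
instance : HasZeroMorphisms (Point B) where
  zero P Q := ⟨⟨P.π ≫ Q.σ, by simp, by simp [← Category.assoc]⟩⟩
  comp_zero {P Q} f R := by
    apply Hom.ext
    change f.hom ≫ Q.π ≫ R.σ = P.π ≫ R.σ
    simp [← Category.assoc]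
  zero_comp P {Q R} f := by
    apply Hom.ext
    change (P.π ≫ Q.σ) ≫ f.hom = P.π ≫ R.σ
    simp

@[simp] lemma zero_hom (P Q : Point B) : (0 : P ⟶ Q).hom = P.π ≫ Q.σ := rfl

instance : HasZeroObject (Point B) where
  zero := ⟨⟨B, 𝟙 B, 𝟙 B, by simp⟩, by
    rw [IsZero.iff_id_eq_zero]
    ext
    simp⟩

section Pullbacks

variable [HasPullbacks C]

/-- The product of two points over `B`, carried by the fibre product over `B`. -/
def prodPoint (P Q : Point B) : Point B where
  obj := pullback P.π Q.π
  π := pullback.fst P.π Q.π ≫ P.π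
  σ := pullback.lift P.σ Q.σ (by simp)
  σ_π := by simp [pullback.lift_fst_assoc]

/-- The product cone of two points over `B`. -/
def prodFan (P Q : Point B) : BinaryFan P Q :=
  BinaryFan.mk (P := prodPoint P Q)
    (⟨pullback.fst P.π Q.π, rfl, pullback.lift_fst _ _ _⟩ : Hom (prodPoint P Q) P)
    (⟨pullback.snd P.π Q.π, pullback.condition.symm, pullback.lift_snd _ _ _⟩ :
      Hom (prodPoint P Q) Q)

/-- The fibre product over `B` is the product in `Pt_B(C)`. -/
def prodFanIsLimit (P Q : Point B) : IsLimit (prodFan P Q) :=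
  BinaryFan.IsLimit.mk _
    (fun {T} f g =>
      (⟨pullback.lift f.hom g.hom (by simp), by simp [prodPoint, pullback.lift_fst_assoc], by
        apply pullback.hom_ext <;> simp [prodPoint, pullback.lift_fst, pullback.lift_snd]⟩ : Hom T (prodPoint P Q)))
    (fun f g => by
      apply Hom.ext
      exact pullback.lift_fst _ _ _)
    (fun f g => by
      apply Hom.ext
      exact pullback.lift_snd _ _ _)
    (fun f g m h₁ h₂ => by
      apply Hom.ext
      apply pullback.hom_ext
      · exact (congrArg Hom.hom h₁).trans (pullback.lift_fst _ _ _).symm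
      · exact (congrArg Hom.hom h₂).trans (pullback.lift_snd _ _ _).symm)

instance : HasBinaryProducts (Point B) :=
  have (P Q : Point B) : HasLimit (pair P Q) := ⟨⟨⟨prodFan P Q, prodFanIsLimit P Q⟩⟩⟩
  hasBinaryProducts_of_hasLimit_pair _

/-- The change of base functor `p^* : Pt_B(C) ⥤ Pt_E(C)` of the fibration of points, given by
pulling back along `p : E ⟶ B`. -/
def baseChange {E B : C} (p : E ⟶ B) : Point B ⥤ Point E where
  obj P :=
    { obj := pullback P.π p
      π := pullback.snd P.π p
      σ := pullback.lift (p ≫ P.σ) (𝟙 E) (by simp)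
      σ_π := pullback.lift_snd _ _ _ }
  map {P Q} f :=
    { hom := pullback.lift (pullback.fst P.π p ≫ f.hom) (pullback.snd P.π p)
        (by simp [pullback.condition])
      hom_π := pullback.lift_snd _ _ _
      σ_hom := by
        apply pullback.hom_ext <;>
          simp [pullback.lift_fst, pullback.lift_snd, pullback.lift_fst_assoc] }
  map_id P := by
    apply Hom.ext
    apply pullback.hom_ext <;> simp
  map_comp f g := by
    apply Hom.ext
    apply pullback.hom_ext <;>
      simp [pullback.lift_fst, pullback.lift_snd, pullback.lift_fst_assoc]

end Pullbacks

end Point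

/-! ### Semi-abelian categories -/

/-- A semi-abelian category: pointed, Barr exact, Bourn protomodular, with finite coproducts. -/
class SemiAbelian (C : Type u) [Category.{v} C] : Prop
    extends Regular C, HasZeroObject C where
  hasFiniteCoproducts : HasFiniteCoproducts C
  /-- Barr exactness: every internal equivalence relation is a kernel pair. -/
  exact : ∀ {R A : C} (p₁ p₂ : R ⟶ A), IsEquivalenceRelation p₁ p₂ →
    ∃ (Q : C) (q : A ⟶ Q), IsKernelPair q p₁ p₂
  /-- Bourn protomodularity: the change of base functors of the fibration of points reflect
  isomorphisms. -/
  protomodular : ∀ {E B : C} (p : E ⟶ B), (Point.baseChange p).ReflectsIsomorphisms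

attribute [instance] SemiAbelian.hasFiniteCoproducts

/-! ### Commutation -/

/-- The morphisms `x` and `y` Huq-commute: there is `φ : X ⨯ Y ⟶ D` with `φ ∘ ⟨1, 0⟩ = x` and
`φ ∘ ⟨0, 1⟩ = y`. -/
def HuqCommute {C : Type u} [Category.{v} C] [HasZeroMorphisms C] [HasBinaryProducts C]
    {X Y D : C} (x : X ⟶ D) (y : Y ⟶ D) : Prop :=
  ∃ φ : X ⨯ Y ⟶ D, prod.lift (𝟙 X) 0 ≫ φ = x ∧ prod.lift 0 (𝟙 Y) ≫ φ = y

/-- Condition (SSH): every change of base functor of the fibration of points reflects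
Huq-commutation of arbitrary cospans. -/
def SSH (C : Type u) [Category.{v} C] [HasPullbacks C] : Prop :=
  ∀ {E B : C} (p : E ⟶ B) {P Q R : Point B} (α : P ⟶ R) (γ : Q ⟶ R),
    HuqCommute ((Point.baseChange p).map α) ((Point.baseChange p).map γ) → HuqCommute α γ

/-- For points `P = (A, f, r)` and `Q = (C, g, s)` over `B` and morphisms `α : A ⟶ D`,
`γ : C ⟶ D`, admissibility of `(α, β, γ)` with respect to `(f, r, g, s)`, where
`β = α ∘ r = γ ∘ s`: there is `φ : A ×_B C ⟶ D` with `φ ∘ ⟨1, s ∘ f⟩ = α` and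
`φ ∘ ⟨r ∘ g, 1⟩ = γ`. -/
def Admissible [HasPullbacks C] {B D : C} (P Q : Point B) (α : P.obj ⟶ D) (γ : Q.obj ⟶ D) :
    Prop :=
  ∃ φ : pullback P.π Q.π ⟶ D,
    pullback.lift (𝟙 P.obj) (P.π ≫ Q.σ) (by simp) ≫ φ = α ∧
    pullback.lift (Q.π ≫ P.σ) (𝟙 Q.obj) (by simp) ≫ φ = γ

/-- The point `[1, 0] : W ⨿ X ⟶ W` with section the coproduct inclusion. -/
def coprodPoint [HasZeroMorphisms C] [HasBinaryCoproducts C] (W X : C) : Point W where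
  obj := W ⨿ X
  π := coprod.desc (𝟙 W) 0
  σ := coprod.inl
  σ_π := coprod.inl_desc _ _

/-- For a weighted cospan `(x, y, w)`: the morphisms `x` and `y` commute over `w`. -/
def CommuteOver [HasZeroMorphisms C] [HasBinaryCoproducts C] [HasPullbacks C]
    {X Y W D : C} (x : X ⟶ D) (y : Y ⟶ D) (w : W ⟶ D) : Prop :=
  Admissible (coprodPoint W X) (coprodPoint W Y) (coprod.desc w x) (coprod.desc w y)

/-! ### Higgins commutators -/

section Higgins

variable [HasZeroMorphisms C] [SemiAbelian C]

/-- The canonical morphism `K + L ⟶ K × L`. -/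
def binaryComparison (K L : C) : K ⨿ L ⟶ K ⨯ L :=
  coprod.desc (prod.lift (𝟙 K) 0) (prod.lift 0 (𝟙 L))

/-- The canonical morphism `K + L + M ⟶ (K + L) × (K + M) × (L + M)`. -/
def ternaryComparison (K L M : C) :
    (K ⨿ L) ⨿ M ⟶ ((K ⨿ L) ⨯ (K ⨿ M)) ⨯ (L ⨿ M) :=
  coprod.desc
    (coprod.desc
      (prod.lift (prod.lift coprod.inl coprod.inl) 0)
      (prod.lift (prod.lift coprod.inr 0) coprod.inl))
    (prod.lift (prod.lift 0 coprod.inr) coprod.inr)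

/-- The binary Higgins commutator `[K, L] ≤ D`: the image of the co-smash product `K ⋄ L`. -/
def higgins {D : C} (K L : Subobject D) : Subobject D :=
  imageSubobject
    (kernel.ι (binaryComparison (K : C) (L : C)) ≫ coprod.desc K.arrow L.arrow)

/-- The ternary Higgins commutator `[K, L, M] ≤ D`: the image of the co-smash product
`K ⋄ L ⋄ M`. -/
def higgins₃ {D : C} (K L M : Subobject D) : Subobject D :=
  imageSubobject
    (kernel.ι (ternaryComparison (K : C) (L : C) (M : C)) ≫
      coprod.desc (coprod.desc K.arrow L.arrow) M.arrow)

/-- The subobject `X` of `D` is `w`-normal: `[Im w, X] ≤ X`. -/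
def WNormal {W D : C} (w : W ⟶ D) (X : Subobject D) : Prop :=
  higgins (imageSubobject w) X ≤ X

/-- The cospan `(x, y)` is `w`-proper: the images of `x` and `y` are `w`-normal. -/
def WProper {X Y W D : C} (x : X ⟶ D) (y : Y ⟶ D) (w : W ⟶ D) : Prop :=
  WNormal w (imageSubobject x) ∧ WNormal w (imageSubobject y)

end Higgins

end SemiAb

end

/-!
Pulling a point back along `0 ⟶ B` amounts to taking its kernel, so (SSH) says that the kernel
functors `Pt_B(C) ⥤ C` reflect Huq-commutation. A point over `B` with kernel `K` is a regular
quotient of `B + K`, so two morphisms of points with codomain `R` Huq-commute as soon as their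
restrictions to the kernels commute over the weight `R.σ`; since kernels are normalized by the
section, this yields (ii) ⇒ (i). Conversely, a weight `w : W ⟶ D` turns `[w, x]` and `[w, y]` into
morphisms to the point `(W × D, π_W, ⟨1, w⟩)`, and properness lets Huq-commutation of `x` and `y`
pass to the kernels of `[1, 0] : W + X ⟶ W` and `[1, 0] : W + Y ⟶ W`.

The canonical morphism `X + Y + W ⟶ (W + X) ×_W (W + Y)` is a regular epimorphism whose kernel is a
split extension of `X ⋄ Y` by `X ⋄ Y ⋄ W`. Hence `x` and `y` commute over `w` if and only if both
`[x, y]` and `[x, y, w]` vanish. This gives (ii) ⇔ (iv) and, as commuting over the zero weight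
amounts to Huq-commuting, (ii) ⇔ (iii).
-/

noncomputable section

namespace SemiAb

open ZeroObject

variable {C : Type u} [Category.{v} C]

attribute [local simp] prod.lift_fst prod.lift_snd prod.lift_fst_assoc prod.lift_snd_assoc
  pullback.lift_fst pullback.lift_snd pullback.lift_fst_assoc pullback.lift_snd_assoc
  coprod.inl_desc coprod.inr_desc coprod.inl_desc_assoc coprod.inr_desc_assoc

-- lets `simp` see the carriers of these points
attribute [reducible] coprodPoint Point.prodPoint Point.baseChange

/-! ### Points and Huq-commutation -/

namespace Point

@[simp]
lemma σ_π_assoc {B D : C} (P : Point B) (z : B ⟶ D) : P.σ ≫ P.π ≫ z = z := by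
  rw [reassoc_of% P.σ_π]

@[simp]
lemma hom_π_assoc {B D : C} {P Q : Point B} (f : P ⟶ Q) (z : B ⟶ D) :
    f.hom ≫ Q.π ≫ z = P.π ≫ z := by
  rw [reassoc_of% f.hom_π]

lemma isIso_of_isIso_hom {B : C} {P Q : Point B} (f : P ⟶ Q) [IsIso f.hom] : IsIso f :=
  ⟨(⟨inv f.hom, by rw [IsIso.inv_comp_eq, f.hom_π], by rw [IsIso.comp_inv_eq, f.σ_hom]⟩ :
    Hom Q P), hom_ext (IsIso.hom_inv_id f.hom), hom_ext (IsIso.inv_hom_id f.hom)⟩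

/-- A morphism of points along a morphism `b` of the bases, that is, a morphism over `b` in the
total category of the fibration of points. -/
structure HomOver {B' B : C} (b : B' ⟶ B) (P' : Point B') (P : Point B) where
  hom : P'.obj ⟶ P.obj
  hom_π : hom ≫ P.π = P'.π ≫ b
  σ_hom : P'.σ ≫ hom = b ≫ P.σ

section Pullbacks

variable [HasPullbacks C] {B : C}

/-- The inclusion `⟨1, Q.σ ∘ P.π⟩` of the first factor into the product of two points. -/
abbrev prodInl (P Q : Point B) : P.obj ⟶ pullback P.π Q.π :=
  pullback.lift (𝟙 P.obj) (P.π ≫ Q.σ) (by simp)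

/-- The inclusion `⟨P.σ ∘ Q.π, 1⟩` of the second factor into the product of two points. -/
abbrev prodInr (P Q : Point B) : Q.obj ⟶ pullback P.π Q.π :=
  pullback.lift (Q.π ≫ P.σ) (𝟙 Q.obj) (by simp)

lemma σ_prodInl (P Q : Point B) : P.σ ≫ prodInl P Q = Q.σ ≫ prodInr P Q := by
  apply pullback.hom_ext <;> simp

end Pullbacks

end Point

open Point

namespace Admissible

variable [HasPullbacks C] {B D : C} {P Q : Point B} {α : P.obj ⟶ D} {γ : Q.obj ⟶ D}

lemma symm (h : Admissible P Q α γ) : Admissible Q P γ α := by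
  obtain ⟨φ, hα, hγ⟩ := h
  refine ⟨(pullbackSymmetry Q.π P.π).hom ≫ φ, ?_, ?_⟩
  · rw [← hγ, ← Category.assoc]
    congr 1
    apply pullback.hom_ext <;> simp
  · rw [← hα, ← Category.assoc]
    congr 1
    apply pullback.hom_ext <;> simp

lemma postcomp {D' : C} (h : Admissible P Q α γ) (k : D ⟶ D') :
    Admissible P Q (α ≫ k) (γ ≫ k) := by
  obtain ⟨φ, rfl, rfl⟩ := h
  exact ⟨φ ≫ k, by simp, by simp⟩

lemma precomp {B' : C} {b : B' ⟶ B} {P' Q' : Point B'} (h : Admissible P Q α γ)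
    (f : HomOver b P' P) (g : HomOver b Q' Q) :
    Admissible P' Q' (f.hom ≫ α) (g.hom ≫ γ) := by
  obtain ⟨φ, rfl, rfl⟩ := h
  refine ⟨pullback.map _ _ _ _ f.hom g.hom b f.hom_π.symm g.hom_π.symm ≫ φ, ?_, ?_⟩
  all_goals
    simp only [← Category.assoc]
    congr 1
    apply pullback.hom_ext <;>
      simp [reassoc_of% f.hom_π, reassoc_of% g.hom_π, f.σ_hom, g.σ_hom]

end Admissible

section Huq

variable [HasZeroMorphisms C]

section BinaryProducts

variable [HasBinaryProducts C] {X Y D : C} {x : X ⟶ D} {y : Y ⟶ D}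

lemma HuqCommute.precomp {X' Y' : C} (h : HuqCommute x y) (a : X' ⟶ X) (b : Y' ⟶ Y) :
    HuqCommute (a ≫ x) (b ≫ y) := by
  obtain ⟨φ, rfl, rfl⟩ := h
  refine ⟨prod.map a b ≫ φ, ?_, ?_⟩
  all_goals
    simp only [← Category.assoc]
    congr 1
    apply Limits.prod.hom_ext <;> simp

lemma HuqCommute.postcomp {D' : C} (h : HuqCommute x y) (k : D ⟶ D') :
    HuqCommute (x ≫ k) (y ≫ k) := by
  obtain ⟨φ, rfl, rfl⟩ := h
  exact ⟨φ ≫ k, by simp, by simp⟩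

lemma huqCommute_iff_of_isLimit {P : C} {p : P ⟶ X} {q : P ⟶ Y} (hP : IsLimit (BinaryFan.mk p q))
    {i : X ⟶ P} {j : Y ⟶ P} (i_p : i ≫ p = 𝟙 X) (i_q : i ≫ q = 0) (j_p : j ≫ p = 0)
    (j_q : j ≫ q = 𝟙 Y) :
    HuqCommute x y ↔ ∃ φ : P ⟶ D, i ≫ φ = x ∧ j ≫ φ = y := by
  let e : X ⨯ Y ≅ P := (prodIsProd X Y).conePointUniqueUpToIso hP
  have e_p : e.hom ≫ p = prod.fst :=
    (prodIsProd X Y).conePointUniqueUpToIso_hom_comp hP ⟨WalkingPair.left⟩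
  have e_q : e.hom ≫ q = prod.snd :=
    (prodIsProd X Y).conePointUniqueUpToIso_hom_comp hP ⟨WalkingPair.right⟩
  have hi : prod.lift (𝟙 X) 0 ≫ e.hom = i := by
    apply BinaryFan.IsLimit.hom_ext hP <;> simp [e_p, e_q, i_p, i_q]
  have hj : prod.lift 0 (𝟙 Y) ≫ e.hom = j := by
    apply BinaryFan.IsLimit.hom_ext hP <;> simp [e_p, e_q, j_p, j_q]
  constructor
  · rintro ⟨φ, rfl, rfl⟩
    exact ⟨e.inv ≫ φ, by simp [← hi], by simp [← hj]⟩
  · rintro ⟨φ, rfl, rfl⟩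
    exact ⟨e.hom ≫ φ, by simp [← hi], by simp [← hj]⟩

end BinaryProducts

variable [HasZeroObject C]

/-- An object, viewed as a point over the zero object. -/
abbrev zeroPoint (X : C) : Point (0 : C) where
  obj := X
  π := 0
  σ := 0
  σ_π := (isZero_zero C).eq_of_src _ _

lemma huqCommute_iff_admissible_zeroPoint [HasBinaryProducts C] [HasPullbacks C] {X Y D : C}
    (x : X ⟶ D) (y : Y ⟶ D) :
    HuqCommute x y ↔ Admissible (zeroPoint X) (zeroPoint Y) x y :=
  huqCommute_iff_of_isLimit
    (isProductOfIsTerminalIsPullback _ _ _ _ (isZero_zero C).isTerminal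
      (pullbackIsPullback (zeroPoint X).π (zeroPoint Y).π))
    (pullback.lift_fst _ _ _) ((pullback.lift_snd _ _ _).trans comp_zero)
    ((pullback.lift_fst _ _ _).trans comp_zero) (pullback.lift_snd _ _ _)

end Huq

/-- Two morphisms with the same codomain are jointly extremal-epic: no proper subobject contains
both of them. -/
def JointlyExtremalEpi {A A' T : C} (f : A ⟶ T) (g : A' ⟶ T) : Prop :=
  ∀ S : Subobject T, S.Factors f → S.Factors g → S = ⊤

namespace JointlyExtremalEpi

variable {A A' T D : C} {f : A ⟶ T} {g : A' ⟶ T}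

lemma factors [HasPullbacks C] (h : JointlyExtremalEpi f g) {u : T ⟶ D} {S : Subobject D}
    (hf : S.Factors (f ≫ u)) (hg : S.Factors (g ≫ u)) : S.Factors u := by
  have pullback_eq_top : (Subobject.pullback u).obj S = ⊤ :=
    h _ ((pullback_factors_iff _ _ _).2 hf) ((pullback_factors_iff _ _ _).2 hg)
  simpa using (pullback_factors_iff u S (𝟙 T)).1
    (pullback_eq_top ▸ Subobject.top_factors _)

lemma hom_ext [HasEqualizers C] (h : JointlyExtremalEpi f g) {u v : T ⟶ D}
    (hf : f ≫ u = f ≫ v) (hg : g ≫ u = g ≫ v) : u = v := by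
  have equalizer_eq_top : equalizerSubobject u v = ⊤ :=
    h _ ((equalizerSubobject_factors_iff u v f).2 hf) ((equalizerSubobject_factors_iff u v g).2 hg)
  simpa using (equalizerSubobject_factors_iff u v (𝟙 T)).1
    (equalizer_eq_top ▸ Subobject.top_factors _)

lemma symm (h : JointlyExtremalEpi f g) : JointlyExtremalEpi g f :=
  fun S hg hf => h S hf hg

lemma of_comp {B B' : C} {a : B ⟶ A} {b : B' ⟶ A'} (h : JointlyExtremalEpi (a ≫ f) (b ≫ g)) :
    JointlyExtremalEpi f g :=
  fun S hf hg => h S (S.factors_of_factors_right a hf) (S.factors_of_factors_right b hg)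

lemma isRegularEpi_coprodDesc [Regular C] [HasBinaryCoproducts C]
    (h : JointlyExtremalEpi f g) : IsRegularEpi (coprod.desc f g) := by
  have : ExtremalEpi (coprod.desc f g) := ExtremalEpi.mk_of_hasEqualizers _ fun S p i hp hi => by
    rw [Subobject.isIso_iff_mk_eq_top]
    refine h _ ((Subobject.mk_factors_iff _ _).2 ⟨coprod.inl ≫ p, ?_⟩)
      ((Subobject.mk_factors_iff _ _).2 ⟨coprod.inr ≫ p, ?_⟩)
    all_goals
      change (_ ≫ p) ≫ i = _
      rw [Category.assoc, hp]
      simp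
  infer_instance

end JointlyExtremalEpi

/-! ### Protomodularity -/

/-- Bourn protomodularity: the change of base functors of the fibration of points reflect
isomorphisms. -/
class Protomodular (C : Type u) [Category.{v} C] [HasPullbacks C] : Prop where
  reflectsIsomorphisms : ∀ {E B : C} (p : E ⟶ B), (Point.baseChange p).ReflectsIsomorphisms

section Pointed

variable [HasZeroMorphisms C] [HasFiniteLimits C]

lemma kernel_ι_comp_eq_zero_iff {X Y D : C} (f : X ⟶ Y) (d : X ⟶ D) :
    kernel.ι f ≫ d = 0 ↔ ∀ ⦃T : C⦄ (t : T ⟶ X), t ≫ f = 0 → t ≫ d = 0 := by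
  refine ⟨fun h T t ht => ?_, fun h => h _ (kernel.condition f)⟩
  rw [← kernel.lift_ι f t ht, Category.assoc, h, comp_zero]

lemma comp_snd_prodInr {B T : C} {P Q : Point B} (t : T ⟶ pullback P.π Q.π)
    (ht : t ≫ pullback.fst P.π Q.π = 0) :
    (t ≫ pullback.snd P.π Q.π) ≫ prodInr P Q = t := by
  apply pullback.hom_ext
  · simp only [Category.assoc, pullback.lift_fst, ht]
    rw [← pullback.condition_assoc, reassoc_of% ht, zero_comp]
  · simp

end Pointed

section Protomodular

variable [HasZeroMorphisms C] [HasFiniteLimits C] [HasZeroObject C] [Protomodular C]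

namespace Point

variable {B : C}

lemma jointlyExtremalEpi_kernel_ι_σ (P : Point B) : JointlyExtremalEpi (kernel.ι P.π) P.σ := by
  intro S hι hσ
  let Q : Point B := ⟨S, S.arrow ≫ P.π, S.factorThru P.σ hσ, by simp⟩
  let μ : Q ⟶ P := (⟨S.arrow, rfl, S.factorThru_arrow _ hσ⟩ : Hom Q P)
  let p : (0 : C) ⟶ B := 0
  have fst_comp_π : pullback.fst P.π p ≫ P.π = 0 := by
    rw [pullback.condition, comp_zero]
  have factors_fst : S.Factors (pullback.fst P.π p) := by
    rw [← kernel.lift_ι P.π _ fst_comp_π]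
    exact S.factors_of_factors_right _ hι
  let s : pullback P.π p ⟶ pullback (S.arrow ≫ P.π) p :=
    pullback.lift (S.factorThru _ factors_fst) (pullback.snd P.π p) (by simp [pullback.condition])
  have s_comp : s ≫ ((baseChange p).map μ).hom = 𝟙 _ := by
    apply pullback.hom_ext <;> simp [s, baseChange, μ, Q]
  have comp_s : ((baseChange p).map μ).hom ≫ s = 𝟙 _ := by
    apply pullback.hom_ext
    · rw [← cancel_mono S.arrow]
      simp [s, baseChange, μ, Q]
    · simp [s, baseChange, μ, Q]
  have : IsIso ((baseChange p).map μ).hom := ⟨s, comp_s, s_comp⟩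
  have : IsIso ((baseChange p).map μ) := isIso_of_isIso_hom _
  have := Protomodular.reflectsIsomorphisms p
  have : IsIso μ := isIso_of_reflects_iso μ (baseChange p)
  rw [← Subobject.isIso_arrow_iff_eq_top]
  exact ⟨(inv μ).hom, congrArg Hom.hom (IsIso.hom_inv_id μ), congrArg Hom.hom (IsIso.inv_hom_id μ)⟩

lemma jointlyExtremalEpi_prodInl_prodInr (P Q : Point B) :
    JointlyExtremalEpi (prodInl P Q) (prodInr P Q) := by
  let F : Point P.obj := ⟨pullback P.π Q.π, pullback.fst P.π Q.π, prodInl P Q, by simp⟩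
  refine .symm (.of_comp (a := kernel.ι F.π ≫ pullback.snd P.π Q.π) (b := 𝟙 P.obj) ?_)
  rw [comp_snd_prodInr _ (kernel.condition F.π), Category.id_comp]
  exact F.jointlyExtremalEpi_kernel_ι_σ

end Point

lemma jointlyExtremalEpi_prod_lift (X Y : C) :
    JointlyExtremalEpi (prod.lift (𝟙 X) (0 : X ⟶ Y)) (prod.lift 0 (𝟙 Y)) := by
  let F : Point X := ⟨X ⨯ Y, prod.fst, prod.lift (𝟙 X) 0, by simp⟩
  refine .symm (.of_comp (a := kernel.ι F.π ≫ prod.snd) (b := 𝟙 X) ?_)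
  have kernel_eq : (kernel.ι F.π ≫ prod.snd) ≫ prod.lift 0 (𝟙 Y) = kernel.ι F.π := by
    apply Limits.prod.hom_ext
    · simpa using (show kernel.ι F.π ≫ prod.fst = 0 from kernel.condition F.π).symm
    · simp
  rw [kernel_eq, Category.id_comp]
  exact F.jointlyExtremalEpi_kernel_ι_σ

lemma exists_fac_iff {A X D : C} (q : A ⟶ X) [IsRegularEpi q] (d : A ⟶ D) :
    (∃ φ, q ≫ φ = d) ↔ kernel.ι q ≫ d = 0 := by
  refine ⟨by rintro ⟨φ, rfl⟩; simp, fun hd => ?_⟩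
  apply IsRegularEpi.exists_of_isKernelPair q (IsKernelPair.of_hasPullback q) d
  let F : Point A := ⟨pullback q q, pullback.fst q q, pullback.lift (𝟙 A) (𝟙 A) rfl, by simp⟩
  have kernel_comp_fst : kernel.ι F.π ≫ pullback.fst q q = 0 := kernel.condition F.π
  apply F.jointlyExtremalEpi_kernel_ι_σ.hom_ext
  · rw [reassoc_of% kernel_comp_fst, zero_comp, ← Category.assoc]
    refine ((kernel_ι_comp_eq_zero_iff q d).1 hd _ ?_).symm
    rw [Category.assoc, ← pullback.condition, reassoc_of% kernel_comp_fst, zero_comp]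
  · simp [F]

lemma Point.HomOver.kernel_ι_hom_comp_eq_zero_iff {B' B D : C} {b : B' ⟶ B} {P' : Point B'}
    {P : Point B} (f : HomOver b P' P) (d : P'.obj ⟶ D) :
    kernel.ι f.hom ≫ d = 0 ↔ kernel.ι b ≫ P'.σ ≫ d = 0 ∧
      ∀ ⦃T : C⦄ (t : T ⟶ P'.obj), t ≫ f.hom = 0 → t ≫ P'.π = 0 → t ≫ d = 0 := by
  refine ⟨fun h => ⟨?_, fun T t ht _ => (kernel_ι_comp_eq_zero_iff _ d).1 h t ht⟩,
    fun ⟨hσ, h⟩ => ?_⟩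
  · rw [← Category.assoc]
    apply (kernel_ι_comp_eq_zero_iff _ d).1 h
    rw [Category.assoc, f.σ_hom, kernel.condition_assoc, zero_comp]
  · let K : Point (kernel b) :=
      { obj := kernel f.hom
        π := kernel.lift b (kernel.ι f.hom ≫ P'.π) (by
          rw [Category.assoc, ← f.hom_π, kernel.condition_assoc, zero_comp])
        σ := kernel.lift f.hom (kernel.ι b ≫ P'.σ) (by
          rw [Category.assoc, f.σ_hom, kernel.condition_assoc, zero_comp])
        σ_π := by
          rw [← cancel_mono (kernel.ι b)]
          simp }
    have kernel_comp_π : kernel.ι K.π ≫ kernel.ι f.hom ≫ P'.π = 0 := by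
      rw [← kernel.lift_ι b (kernel.ι f.hom ≫ P'.π) (by
        rw [Category.assoc, ← f.hom_π, kernel.condition_assoc, zero_comp]),
        kernel.condition_assoc, zero_comp]
    apply K.jointlyExtremalEpi_kernel_ι_σ.hom_ext
    · rw [comp_zero, ← Category.assoc]
      exact h _ (by simp) (by simp [kernel_comp_π])
    · simp [K, hσ]

lemma Admissible.of_comp_mono {B D D' : C} {P Q : Point B} {α : P.obj ⟶ D} {γ : Q.obj ⟶ D}
    (m : D ⟶ D') [Mono m] (h : Admissible P Q (α ≫ m) (γ ≫ m)) : Admissible P Q α γ := by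
  obtain ⟨φ, hα, hγ⟩ := h
  have factors_φ : (Subobject.mk m).Factors φ := by
    apply (jointlyExtremalEpi_prodInl_prodInr P Q).factors
    · exact (Subobject.mk_factors_iff _ _).2 ⟨α, hα.symm⟩
    · exact (Subobject.mk_factors_iff _ _).2 ⟨γ, hγ.symm⟩
  obtain ⟨ψ, rfl⟩ : ∃ ψ : pullback P.π Q.π ⟶ D, ψ ≫ m = φ :=
    (Subobject.mk_factors_iff _ _).1 factors_φ
  rw [← Category.assoc, cancel_mono] at hα hγ
  exact ⟨ψ, hα, hγ⟩

lemma huqCommute_iff_admissible_hom {B : C} {P Q R : Point B} (α : P ⟶ R) (γ : Q ⟶ R) :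
    HuqCommute α γ ↔ Admissible P Q α.hom γ.hom := by
  let i : P ⟶ prodPoint P Q :=
    (⟨prodInl P Q, by simp [prodPoint], by apply pullback.hom_ext <;> simp [prodPoint]⟩ :
      Hom P (prodPoint P Q))
  let j : Q ⟶ prodPoint P Q :=
    (⟨prodInr P Q, by simp [prodPoint], by apply pullback.hom_ext <;> simp [prodPoint]⟩ :
      Hom Q (prodPoint P Q))
  rw [huqCommute_iff_of_isLimit (prodFanIsLimit P Q) (i := i) (j := j)
    (Hom.ext (pullback.lift_fst _ _ _)) (Hom.ext (pullback.lift_snd _ _ _))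
    (Hom.ext (pullback.lift_fst _ _ _)) (Hom.ext (pullback.lift_snd _ _ _))]
  constructor
  · rintro ⟨φ, rfl, rfl⟩
    exact ⟨φ.hom, rfl, rfl⟩
  · rintro ⟨φ, hα, hγ⟩
    have φ_π : φ ≫ R.π = pullback.fst P.π Q.π ≫ P.π := by
      apply (jointlyExtremalEpi_prodInl_prodInr P Q).hom_ext
      · simp [reassoc_of% hα]
      · simp [reassoc_of% hγ]
    have σ_φ : (prodPoint P Q).σ ≫ φ = R.σ := by
      rw [← i.σ_hom, Category.assoc, hα, α.σ_hom]
    exact ⟨(⟨φ, φ_π, σ_φ⟩ : Hom (prodPoint P Q) R), Hom.ext hα, Hom.ext hγ⟩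

section KernelFunctor

variable {B : C} {P Q R : Point B} {α : P ⟶ R} {γ : Q ⟶ R}

lemma huqCommute_kernel_of_baseChange {E : C} (p : E ⟶ B)
    (h : HuqCommute ((baseChange p).map α) ((baseChange p).map γ)) :
    HuqCommute (kernel.ι P.π ≫ α.hom) (kernel.ι Q.π ≫ γ.hom) := by
  let inclusion (S : Point B) :
      HomOver (0 : 0 ⟶ E) (zeroPoint (kernel S.π)) ((baseChange p).obj S) :=
    { hom := pullback.lift (kernel.ι S.π) 0 (by simp)
      hom_π := by simp [baseChange]
      σ_hom := (isZero_zero C).eq_of_src _ _ }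
  rw [huqCommute_iff_admissible_hom] at h
  simpa [inclusion, baseChange] using huqCommute_iff_admissible_zeroPoint _ _ |>.2 <|
    (h.precomp (inclusion P) (inclusion Q)).postcomp (pullback.fst R.π p)

lemma huqCommute_baseChange_zero
    (h : HuqCommute (kernel.ι P.π ≫ α.hom) (kernel.ι Q.π ≫ γ.hom)) :
    HuqCommute ((baseChange (0 : 0 ⟶ B)).map α) ((baseChange (0 : 0 ⟶ B)).map γ) := by
  let toKernel (S : Point B) :
      HomOver (𝟙 0) ((baseChange (0 : 0 ⟶ B)).obj S) (zeroPoint (kernel S.π)) :=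
    { hom := kernel.lift S.π (pullback.fst S.π 0) (by rw [pullback.condition, comp_zero])
      hom_π := (isZero_zero C).eq_of_tgt _ _
      σ_hom := (isZero_zero C).eq_of_src _ _ }
  rw [huqCommute_iff_admissible_zeroPoint] at h
  rw [huqCommute_iff_admissible_hom]
  apply Admissible.of_comp_mono (pullback.fst R.π 0)
  simpa [toKernel, baseChange] using h.precomp (toKernel P) (toKernel Q)

end KernelFunctor

lemma ssh_iff_reflects_kernel :
    SSH C ↔ ∀ {B : C} {P Q R : Point B} (α : P ⟶ R) (γ : Q ⟶ R),
      HuqCommute (kernel.ι P.π ≫ α.hom) (kernel.ι Q.π ≫ γ.hom) → HuqCommute α γ :=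
  ⟨fun h _ _ _ _ _ _ hαγ => h 0 _ _ (huqCommute_baseChange_zero hαγ),
    fun h _ _ p _ _ _ α γ hαγ => h α γ (huqCommute_kernel_of_baseChange p hαγ)⟩

end Protomodular

/-! ### Images and regular epimorphisms -/

lemma imageSubobject_le_iff {X Y : C} (f : X ⟶ Y) [HasImage f] (S : Subobject Y) :
    imageSubobject f ≤ S ↔ S.Factors f := by
  refine ⟨fun h => ?_, fun h => imageSubobject_le f (S.factorThru f h) (S.factorThru_arrow f h)⟩
  exact Subobject.factors_of_le f h
    ((Subobject.factors_iff _ _).2 ⟨factorThruImageSubobject f, imageSubobject_arrow_comp f⟩)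

lemma imageSubobject_arrow_eq_self {D : C} (S : Subobject D) [HasImage S.arrow] [HasEqualizers C] :
    imageSubobject S.arrow = S := by
  rw [imageSubobject_mono, Subobject.mk_arrow]

lemma imageSubobject_eq_bot_iff [HasZeroMorphisms C] [HasZeroObject C] {X Y : C} (f : X ⟶ Y)
    [HasImage f] : imageSubobject f = ⊥ ↔ f = 0 := by
  rw [← le_bot_iff, imageSubobject_le_iff, Subobject.bot_factors_iff_zero]

section Regular

variable [Regular C]

instance {X Y : C} (f : X ⟶ Y) : IsRegularEpi (factorThruImageSubobject f) := by
  have : StrongEpi (factorThruImageSubobject f) := strongEpi_comp _ _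
  infer_instance

lemma imageSubobject_factors_iff {X Y T : C} (f : X ⟶ Y) (t : T ⟶ Y) :
    (imageSubobject f).Factors t ↔
      ∃ (T' : C) (q : T' ⟶ T) (_ : IsRegularEpi q) (s : T' ⟶ X), s ≫ f = q ≫ t := by
  constructor
  · intro h
    let t' := (imageSubobject f).factorThru t h
    refine ⟨_, pullback.snd (factorThruImageSubobject f) t', inferInstance, pullback.fst _ _, ?_⟩
    calc pullback.fst _ t' ≫ f
        = (pullback.fst _ t' ≫ factorThruImageSubobject f) ≫ (imageSubobject f).arrow := by
          rw [Category.assoc, imageSubobject_arrow_comp]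
      _ = pullback.snd _ t' ≫ t := by
          rw [pullback.condition, Category.assoc, Subobject.factorThru_arrow]
  · rintro ⟨T', q, _, s, hs⟩
    have sq : CommSq (s ≫ factorThruImageSubobject f) q (imageSubobject f).arrow t :=
      ⟨by rw [Category.assoc, imageSubobject_arrow_comp, hs]⟩
    exact (Subobject.factors_iff _ _).2 ⟨sq.lift, sq.fac_right⟩

lemma imageSubobject_kernel_ι_comp_factors [HasZeroMorphisms C] {B : C} {P R : Point B}
    (α : P ⟶ R) {T : C} {t : T ⟶ R.obj}
    (ht : (imageSubobject α.hom).Factors t) (t_π : t ≫ R.π = 0) :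
    (imageSubobject (kernel.ι P.π ≫ α.hom)).Factors t := by
  obtain ⟨T', q, hq, s, hs⟩ := (imageSubobject_factors_iff _ _).1 ht
  have s_π : s ≫ P.π = 0 := by
    rw [← α.hom_π, reassoc_of% hs, t_π, comp_zero]
  exact (imageSubobject_factors_iff _ _).2 ⟨T', q, hq, kernel.lift P.π s s_π, by simp [hs]⟩

variable [HasZeroMorphisms C] [HasZeroObject C] [Protomodular C]

section Descent

variable {B D : C} {P P' Q Q' : Point B}

lemma Admissible.of_regularEpi_right (e : Q ⟶ Q') [IsRegularEpi e.hom] {α : P.obj ⟶ D}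
    {γ : Q'.obj ⟶ D} (h : Admissible P Q α (e.hom ≫ γ)) : Admissible P Q' α γ := by
  obtain ⟨φ, hα, hγ⟩ := h
  let q : pullback P.π Q.π ⟶ pullback P.π Q'.π :=
    pullback.map _ _ _ _ (𝟙 P.obj) e.hom (𝟙 B) (by simp) (by simp)
  have q_fst : q ≫ pullback.fst P.π Q'.π = pullback.fst P.π Q.π := by simp [q]
  have q_snd : q ≫ pullback.snd P.π Q'.π = pullback.snd P.π Q.π ≫ e.hom := by simp [q]
  have isPullback_q : IsPullback (pullback.snd P.π Q.π) q e.hom (pullback.snd P.π Q'.π) :=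
    .of_bot (by simpa [q_fst] using (IsPullback.of_hasPullback P.π Q.π).flip) q_snd.symm
      (IsPullback.of_hasPullback P.π Q'.π).flip
  have : IsRegularEpi q :=
    Regular.regularEpiIsStableUnderBaseChange.of_isPullback isPullback_q
      (inferInstanceAs (IsRegularEpi e.hom))
  obtain ⟨ψ, rfl⟩ : ∃ ψ, q ≫ ψ = φ := by
    rw [exists_fac_iff, kernel_ι_comp_eq_zero_iff]
    intro T t ht
    have t_fst : t ≫ pullback.fst P.π Q.π = 0 := by rw [← q_fst, reassoc_of% ht, zero_comp]
    have t_snd : t ≫ pullback.snd P.π Q.π ≫ e.hom = 0 := by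
      rw [← q_snd, reassoc_of% ht, zero_comp]
    rw [← comp_snd_prodInr t t_fst, Category.assoc, hγ, Category.assoc, reassoc_of% t_snd,
      zero_comp]
  refine ⟨ψ, ?_, ?_⟩
  · rw [← hα, ← Category.assoc]
    congr 1
    apply pullback.hom_ext <;> simp [q]
  · rw [← cancel_epi e.hom, ← hγ]
    simp only [← Category.assoc]
    congr 1
    apply pullback.hom_ext <;> simp [q]

lemma Admissible.of_regularEpi (e : P ⟶ P') (e' : Q ⟶ Q') [IsRegularEpi e.hom]
    [IsRegularEpi e'.hom] {α : P'.obj ⟶ D} {γ : Q'.obj ⟶ D}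
    (h : Admissible P Q (e.hom ≫ α) (e'.hom ≫ γ)) : Admissible P' Q' α γ :=
  (h.of_regularEpi_right e').symm.of_regularEpi_right e |>.symm

end Descent

lemma HuqCommute.image {X Y D : C} {x : X ⟶ D} {y : Y ⟶ D} (h : HuqCommute x y) :
    HuqCommute (imageSubobject x).arrow (imageSubobject y).arrow := by
  let e {Z : C} (z : Z ⟶ D) : zeroPoint Z ⟶ zeroPoint (imageSubobject z : C) :=
    (⟨factorThruImageSubobject z, by simp, by simp⟩ : Hom _ _)
  have (Z : C) (z : Z ⟶ D) : IsRegularEpi (e z).hom :=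
    inferInstanceAs (IsRegularEpi (factorThruImageSubobject z))
  rw [huqCommute_iff_admissible_zeroPoint] at h ⊢
  exact .of_regularEpi (e x) (e y) (by simpa [e] using h)

end Regular

section Coproducts

variable [HasBinaryCoproducts C]

lemma jointlyExtremalEpi_coprod_inl_inr (X Y : C) :
    JointlyExtremalEpi (coprod.inl : X ⟶ X ⨿ Y) coprod.inr := by
  intro S hX hY
  have : IsSplitEpi S.arrow :=
    ⟨⟨coprod.desc (S.factorThru _ hX) (S.factorThru _ hY), by apply coprod.hom_ext <;> simp⟩⟩
  rw [← Subobject.isIso_arrow_iff_eq_top]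
  exact isIso_of_mono_of_isSplitEpi S.arrow

lemma coprodDesc_factors [HasPullbacks C] {X Y D : C} {x : X ⟶ D} {y : Y ⟶ D} {S : Subobject D}
    (hx : S.Factors x) (hy : S.Factors y) : S.Factors (coprod.desc x y) :=
  (jointlyExtremalEpi_coprod_inl_inr X Y).factors (by simpa using hx) (by simpa using hy)

variable [HasZeroMorphisms C]

lemma CommuteOver.precomp [HasPullbacks C] {X Y W D : C} {x : X ⟶ D} {y : Y ⟶ D} {w : W ⟶ D}
    (h : CommuteOver x y w) {X' Y' W' : C} (a : X' ⟶ X) (b : Y' ⟶ Y) (c : W' ⟶ W) :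
    CommuteOver (a ≫ x) (b ≫ y) (c ≫ w) := by
  let f {Z' Z : C} (g : Z' ⟶ Z) : HomOver c (coprodPoint W' Z') (coprodPoint W Z) :=
    { hom := coprod.map c g
      hom_π := by apply coprod.hom_ext <;> simp
      σ_hom := by simp }
  simpa [f, CommuteOver] using Admissible.precomp h (f a) (f b)

lemma HuqCommute.commuteOver_zero [HasZeroObject C] [HasBinaryProducts C] [HasPullbacks C]
    {X Y D : C} {x : X ⟶ D} {y : Y ⟶ D} (h : HuqCommute x y) (W : C) :
    CommuteOver x y (0 : W ⟶ D) := by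
  let f (Z : C) : HomOver (0 : W ⟶ 0) (coprodPoint W Z) (zeroPoint Z) :=
    { hom := coprod.desc 0 (𝟙 Z)
      hom_π := (isZero_zero C).eq_of_tgt _ _
      σ_hom := by simp }
  rw [huqCommute_iff_admissible_zeroPoint] at h
  simpa [f, CommuteOver] using h.precomp (f X) (f Y)

end Coproducts

/-! ### Higgins commutators of morphisms -/

section Commutators

variable [HasZeroMorphisms C] [HasBinaryCoproducts C]

section Comparison

variable [HasBinaryProducts C]

/-- The canonical morphism `X + Y ⟶ X × Y`, whose kernel is the co-smash product `X ⋄ Y`. -/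
def cosmashComparison (X Y : C) : X ⨿ Y ⟶ X ⨯ Y :=
  coprod.desc (prod.lift (𝟙 X) 0) (prod.lift 0 (𝟙 Y))

/-- The canonical morphism `X + Y + Z ⟶ (X + Y) × (X + Z) × (Y + Z)`, whose kernel is the ternary
co-smash product `X ⋄ Y ⋄ Z`. -/
def cosmashComparison₃ (X Y Z : C) :
    (X ⨿ Y) ⨿ Z ⟶ ((X ⨿ Y) ⨯ (X ⨿ Z)) ⨯ (Y ⨿ Z) :=
  coprod.desc
    (coprod.desc
      (prod.lift (prod.lift coprod.inl coprod.inl) 0)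
      (prod.lift (prod.lift coprod.inr 0) coprod.inl))
    (prod.lift (prod.lift 0 coprod.inr) coprod.inr)

lemma cosmashComparison_eq_lift (X Y : C) :
    cosmashComparison X Y = prod.lift (coprod.desc (𝟙 X) 0) (coprod.desc 0 (𝟙 Y)) := by
  apply coprod.hom_ext <;> apply Limits.prod.hom_ext <;> simp [cosmashComparison]

lemma cosmashComparison_fst (X Y : C) :
    cosmashComparison X Y ≫ prod.fst = coprod.desc (𝟙 X) 0 := by
  simp [cosmashComparison_eq_lift]

lemma cosmashComparison_snd (X Y : C) :
    cosmashComparison X Y ≫ prod.snd = coprod.desc 0 (𝟙 Y) := by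
  simp [cosmashComparison_eq_lift]

lemma cosmashComparison_naturality {X X' Y Y' : C} (a : X' ⟶ X) (b : Y' ⟶ Y) :
    coprod.map a b ≫ cosmashComparison X Y = cosmashComparison X' Y' ≫ prod.map a b := by
  apply coprod.hom_ext <;> apply Limits.prod.hom_ext <;> simp [cosmashComparison]

end Comparison

variable [Regular C] {D : C}

/-- The Higgins commutator of two arbitrary morphisms with the same codomain: the image of the
co-smash product of their domains. -/
def higginsCommutator {X Y : C} (x : X ⟶ D) (y : Y ⟶ D) : Subobject D :=
  imageSubobject (kernel.ι (cosmashComparison X Y) ≫ coprod.desc x y)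

/-- The ternary Higgins commutator of three arbitrary morphisms with the same codomain. -/
def higginsCommutator₃ {X Y Z : C} (x : X ⟶ D) (y : Y ⟶ D) (z : Z ⟶ D) : Subobject D :=
  imageSubobject (kernel.ι (cosmashComparison₃ X Y Z) ≫ coprod.desc (coprod.desc x y) z)

/-- The subobject `K` is normalized by the weight `w`, that is, `[Im w, K] ≤ K`. -/
def IsWeightNormal {W : C} (w : W ⟶ D) (K : Subobject D) : Prop :=
  higginsCommutator (imageSubobject w).arrow K.arrow ≤ K

/-- The cospan `(x, y)` is proper for the weight `w`: the images of `x` and `y` are `w`-normal. -/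
def IsWeightProper {X Y W : C} (x : X ⟶ D) (y : Y ⟶ D) (w : W ⟶ D) : Prop :=
  IsWeightNormal w (imageSubobject x) ∧ IsWeightNormal w (imageSubobject y)

lemma higginsCommutator_le_iff {X Y : C} {x : X ⟶ D} {y : Y ⟶ D} {S : Subobject D} :
    higginsCommutator x y ≤ S ↔
      ∀ ⦃T : C⦄ (t : T ⟶ X ⨿ Y), t ≫ cosmashComparison X Y = 0 →
        S.Factors (t ≫ coprod.desc x y) := by
  rw [higginsCommutator, imageSubobject_le_iff]
  refine ⟨fun h T t ht => ?_, fun h => h _ (kernel.condition _)⟩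
  rw [← kernel.lift_ι _ t ht, Category.assoc]
  exact S.factors_of_factors_right _ h

lemma higginsCommutator_comp_le {X X' Y Y' : C} (a : X' ⟶ X) (b : Y' ⟶ Y) (x : X ⟶ D)
    (y : Y ⟶ D) : higginsCommutator (a ≫ x) (b ≫ y) ≤ higginsCommutator x y := by
  rw [higginsCommutator_le_iff]
  intro T t ht
  have map_comparison : (t ≫ coprod.map a b) ≫ cosmashComparison X Y = 0 := by
    rw [Category.assoc, cosmashComparison_naturality, reassoc_of% ht, zero_comp]
  simpa using higginsCommutator_le_iff.1 le_rfl _ map_comparison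

lemma IsWeightNormal.image {W : C} {w : W ⟶ D} {K : Subobject D} (h : IsWeightNormal w K) :
    IsWeightNormal (imageSubobject w).arrow K := by
  rwa [IsWeightNormal, imageSubobject_arrow_eq_self]

lemma IsWeightProper.image {X Y W : C} {x : X ⟶ D} {y : Y ⟶ D} {w : W ⟶ D}
    (h : IsWeightProper x y w) :
    IsWeightProper (imageSubobject x).arrow (imageSubobject y).arrow (imageSubobject w).arrow := by
  rw [IsWeightProper, imageSubobject_arrow_eq_self, imageSubobject_arrow_eq_self]
  exact ⟨h.1.image, h.2.image⟩

lemma isWeightNormal_imageSubobject_kernel {B : C} {P R : Point B} (α : P ⟶ R) :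
    IsWeightNormal R.σ (imageSubobject (kernel.ι P.π ≫ α.hom)) := by
  set K := imageSubobject (kernel.ι P.π ≫ α.hom)
  rw [IsWeightNormal, higginsCommutator_le_iff]
  intro T t ht
  have K_le : K ≤ imageSubobject α.hom := imageSubobject_comp_le _ _
  have σ_le : imageSubobject R.σ ≤ imageSubobject α.hom := by
    rw [← α.σ_hom]
    exact imageSubobject_comp_le _ _
  have K_π : K.arrow ≫ R.π = 0 := by
    rw [← cancel_epi (factorThruImageSubobject (kernel.ι P.π ≫ α.hom))]
    simp [K, imageSubobject_arrow_comp_assoc]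
  apply imageSubobject_kernel_ι_comp_factors
  · apply Subobject.factors_of_factors_right
    exact coprodDesc_factors ((Subobject.factors_iff _ _).2 ⟨_, Subobject.ofLE_arrow σ_le⟩)
      ((Subobject.factors_iff _ _).2 ⟨_, Subobject.ofLE_arrow K_le⟩)
  · have desc_π : coprod.desc (imageSubobject R.σ).arrow K.arrow ≫ R.π =
        cosmashComparison _ _ ≫ prod.fst ≫ (imageSubobject R.σ).arrow ≫ R.π := by
      rw [reassoc_of% cosmashComparison_fst]
      apply coprod.hom_ext <;> simp [K_π]
    rw [Category.assoc, desc_π, reassoc_of% ht, zero_comp]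

variable [HasZeroObject C] [Protomodular C]

instance (X Y : C) : IsRegularEpi (cosmashComparison X Y) :=
  (jointlyExtremalEpi_prod_lift X Y).isRegularEpi_coprodDesc

lemma huqCommute_iff_higginsCommutator_eq_bot {X Y : C} (x : X ⟶ D) (y : Y ⟶ D) :
    HuqCommute x y ↔ higginsCommutator x y = ⊥ := by
  rw [higginsCommutator, imageSubobject_eq_bot_iff, ← exists_fac_iff]
  refine exists_congr fun φ => ?_
  simp [cosmashComparison, coprod.hom_ext_iff]

lemma higginsCommutator_zero_left {X Y : C} (y : Y ⟶ D) :
    higginsCommutator (0 : X ⟶ D) y = ⊥ := by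
  rw [← huqCommute_iff_higginsCommutator_eq_bot]
  exact ⟨prod.snd ≫ y, by simp, by simp⟩

lemma isWeightProper_zero {X Y : C} (x : X ⟶ D) (y : Y ⟶ D) (W : C) :
    IsWeightProper x y (0 : W ⟶ D) := by
  constructor <;>
    rw [IsWeightNormal, imageSubobject_zero_arrow, higginsCommutator_zero_left] <;>
    exact bot_le

/-- This is where `w`-normality enters: the kernel `W ♭ X` of `[1, 0] : W + X ⟶ W` is generated by
`X` and the co-smash product `W ⋄ X`. -/
lemma IsWeightNormal.factors_kernel_comp_desc {W X : C} {w : W ⟶ D} {x : X ⟶ D}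
    (h : IsWeightNormal w (imageSubobject x)) :
    (imageSubobject x).Factors (kernel.ι (coprodPoint W X).π ≫ coprod.desc w x) := by
  have commutator_le : higginsCommutator w x ≤ imageSubobject x := by
    refine le_trans ?_ h
    simpa using higginsCommutator_comp_le (factorThruImageSubobject w) (factorThruImageSubobject x)
      (imageSubobject w).arrow (imageSubobject x).arrow
  let F : Point X :=
    { obj := kernel (coprodPoint W X).π
      π := kernel.ι (coprodPoint W X).π ≫ coprod.desc 0 (𝟙 X)
      σ := kernel.lift (coprodPoint W X).π coprod.inr (by simp)
      σ_π := by simp }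
  have kernel_comparison :
      (kernel.ι F.π ≫ kernel.ι (coprodPoint W X).π) ≫ cosmashComparison W X = 0 := by
    apply Limits.prod.hom_ext
    · simp [cosmashComparison_fst]
    · simp only [Category.assoc, cosmashComparison_snd, zero_comp]
      exact kernel.condition F.π
  apply F.jointlyExtremalEpi_kernel_ι_σ.factors
  · simpa using higginsCommutator_le_iff.1 commutator_le _ kernel_comparison
  · rw [kernel.lift_ι_assoc, coprod.inr_desc, ← imageSubobject_le_iff]

end Commutators

/-! ### Commutation over a weight -/

section WeightedCommutation

variable [Regular C] [HasZeroMorphisms C] [HasBinaryCoproducts C]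

section Covering

variable (X Y W : C)

/-- The object `(W + X) ×_W (W + Y)` as a point over `X × Y`. -/
abbrev weightedProductPoint : Point (X ⨯ Y) where
  obj := pullback (coprodPoint W X).π (coprodPoint W Y).π
  π := prod.lift (pullback.fst _ _ ≫ coprod.desc 0 (𝟙 X)) (pullback.snd _ _ ≫ coprod.desc 0 (𝟙 Y))
  σ := pullback.lift (prod.fst ≫ coprod.inr) (prod.snd ≫ coprod.inr) (by simp)
  σ_π := by apply Limits.prod.hom_ext <;> simp

/-- The canonical morphism `X + Y + W ⟶ (W + X) ×_W (W + Y)`. It turns commutation over a weight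
into a condition on its kernel. -/
def weightedComparison :
    HomOver (cosmashComparison X Y) (coprodPoint (X ⨿ Y) W) (weightedProductPoint X Y W) where
  hom := coprod.desc
    (coprod.desc (coprod.inr ≫ prodInl (coprodPoint W X) (coprodPoint W Y))
      (coprod.inr ≫ prodInr (coprodPoint W X) (coprodPoint W Y)))
    (coprod.inl ≫ prodInl (coprodPoint W X) (coprodPoint W Y))
  hom_π := by
    apply coprod.hom_ext
    · apply coprod.hom_ext <;> apply Limits.prod.hom_ext <;> simp [cosmashComparison]
    · apply Limits.prod.hom_ext <;> simp
  σ_hom := by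
    apply coprod.hom_ext <;> apply pullback.hom_ext <;> simp [cosmashComparison]

variable {X Y W}

lemma commuteOver_iff_exists_fac {D : C} {x : X ⟶ D} {y : Y ⟶ D} {w : W ⟶ D} :
    CommuteOver x y w ↔
      ∃ φ, (weightedComparison X Y W).hom ≫ φ = coprod.desc (coprod.desc x y) w := by
  refine exists_congr fun φ => ?_
  have inl_prod : coprod.inl ≫ prodInr (coprodPoint W X) (coprodPoint W Y) ≫ φ =
      coprod.inl ≫ prodInl (coprodPoint W X) (coprodPoint W Y) ≫ φ := by
    simpa using congrArg (· ≫ φ) (σ_prodInl (coprodPoint W X) (coprodPoint W Y)).symm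
  simp only [coprod.hom_ext_iff, weightedComparison, Category.assoc, coprod.inl_desc,
    coprod.inr_desc, coprod.inl_desc_assoc, coprod.inr_desc_assoc, inl_prod]
  tauto

lemma comp_weightedComparison_eq_zero_iff {T : C} (t : T ⟶ (X ⨿ Y) ⨿ W) :
    t ≫ (weightedComparison X Y W).hom = 0 ∧ t ≫ (coprodPoint (X ⨿ Y) W).π = 0 ↔
      t ≫ cosmashComparison₃ X Y W = 0 := by
  have comparison_fst : (weightedComparison X Y W).hom ≫ pullback.fst _ _ =
      cosmashComparison₃ X Y W ≫ prod.fst ≫ prod.snd ≫ (coprod.braiding X W).hom := by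
    apply coprod.hom_ext
    · apply coprod.hom_ext <;> simp [weightedComparison, cosmashComparison₃]
    · simp [weightedComparison, cosmashComparison₃]
  have comparison_snd : (weightedComparison X Y W).hom ≫ pullback.snd _ _ =
      cosmashComparison₃ X Y W ≫ prod.snd ≫ (coprod.braiding Y W).hom := by
    apply coprod.hom_ext
    · apply coprod.hom_ext <;> simp [weightedComparison, cosmashComparison₃]
    · simp [weightedComparison, cosmashComparison₃]
  have desc_eq : (coprodPoint (X ⨿ Y) W).π =
      cosmashComparison₃ X Y W ≫ prod.fst ≫ prod.fst := by
    apply coprod.hom_ext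
    · apply coprod.hom_ext <;> simp [cosmashComparison₃]
    · simp [cosmashComparison₃]
  rw [desc_eq]
  constructor
  · rintro ⟨h, h'⟩
    have h₁ := congrArg (· ≫ pullback.fst _ _ ≫ (coprod.braiding X W).inv) h
    have h₂ := congrArg (· ≫ pullback.snd _ _ ≫ (coprod.braiding Y W).inv) h
    simp only [Category.assoc, reassoc_of% comparison_fst, reassoc_of% comparison_snd,
      Iso.hom_inv_id, Category.comp_id, zero_comp] at h₁ h₂
    apply Limits.prod.hom_ext
    · apply Limits.prod.hom_ext <;> simp [h', h₁]
    · simp [h₂]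
  · intro h
    refine ⟨?_, by rw [reassoc_of% h, zero_comp]⟩
    apply pullback.hom_ext <;>
      simp only [Category.assoc, comparison_fst, comparison_snd, reassoc_of% h, zero_comp]

end Covering

variable [HasZeroObject C] [Protomodular C]

instance (X Y W : C) : IsRegularEpi (weightedComparison X Y W).hom := by
  apply JointlyExtremalEpi.isRegularEpi_coprodDesc
  intro S hXY hW
  have hX := S.factors_of_factors_right coprod.inl hXY
  have hY := S.factors_of_factors_right coprod.inr hXY
  simp only [coprod.inl_desc, coprod.inr_desc] at hX hY
  apply jointlyExtremalEpi_prodInl_prodInr _ _ S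
  · exact (jointlyExtremalEpi_coprod_inl_inr W X).factors hW hX
  · refine (jointlyExtremalEpi_coprod_inl_inr W Y).factors ?_ hY
    have inl_prod : coprod.inl ≫ prodInl (coprodPoint W X) (coprodPoint W Y) =
        coprod.inl ≫ prodInr (coprodPoint W X) (coprodPoint W Y) :=
      σ_prodInl (coprodPoint W X) (coprodPoint W Y)
    rwa [← inl_prod]

theorem commuteOver_iff {X Y W D : C} {x : X ⟶ D} {y : Y ⟶ D} {w : W ⟶ D} :
    CommuteOver x y w ↔ HuqCommute x y ∧ higginsCommutator₃ x y w = ⊥ := by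
  rw [commuteOver_iff_exists_fac, exists_fac_iff, HomOver.kernel_ι_hom_comp_eq_zero_iff,
    huqCommute_iff_higginsCommutator_eq_bot, higginsCommutator, higginsCommutator₃,
    imageSubobject_eq_bot_iff, imageSubobject_eq_bot_iff,
    kernel_ι_comp_eq_zero_iff (cosmashComparison₃ X Y W)]
  simp [← comp_weightedComparison_eq_zero_iff]

section Points

variable {B D : C}

/-- A point is covered by the free point on its kernel. -/
def coprodPointToPoint (P : Point B) : coprodPoint B (kernel P.π) ⟶ P :=
  (⟨coprod.desc P.σ (kernel.ι P.π), by apply coprod.hom_ext <;> simp, by simp⟩ : Hom _ _)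

instance (P : Point B) : IsRegularEpi (coprodPointToPoint P).hom :=
  P.jointlyExtremalEpi_kernel_ι_σ.symm.isRegularEpi_coprodDesc

lemma admissible_of_commuteOver {P Q : Point B} {α : P.obj ⟶ D} {γ : Q.obj ⟶ D}
    (hσ : P.σ ≫ α = Q.σ ≫ γ)
    (h : CommuteOver (kernel.ι P.π ≫ α) (kernel.ι Q.π ≫ γ) (P.σ ≫ α)) : Admissible P Q α γ := by
  apply Admissible.of_regularEpi (coprodPointToPoint P) (coprodPointToPoint Q)
  simpa [coprodPointToPoint, CommuteOver, hσ] using h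

end Points

lemma commuteOver_of_ssh (h : SSH C) {X Y W D : C} {x : X ⟶ D} {y : Y ⟶ D} {w : W ⟶ D}
    (proper : IsWeightProper x y w) (huq : HuqCommute x y) : CommuteOver x y w := by
  let R : Point W := ⟨W ⨯ D, prod.fst, prod.lift (𝟙 W) w, by simp⟩
  let graph {Z : C} (z : Z ⟶ D) : coprodPoint W Z ⟶ R :=
    (⟨prod.lift (coprodPoint W Z).π (coprod.desc w z), by simp [R],
      by apply Limits.prod.hom_ext <;> simp [R]⟩ : Hom _ _)
  have kernel_graph {Z : C} (z : Z ⟶ D) : kernel.ι (coprodPoint W Z).π ≫ (graph z).hom =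
      (kernel.ι (coprodPoint W Z).π ≫ coprod.desc w z) ≫ prod.lift 0 (𝟙 D) := by
    apply Limits.prod.hom_ext
    · simp [graph, R]
    · simp [graph, R]
  have kernels_commute : HuqCommute (kernel.ι (coprodPoint W X).π ≫ coprod.desc w x)
      (kernel.ι (coprodPoint W Y).π ≫ coprod.desc w y) := by
    simpa using huq.image.precomp
      (Subobject.factorThru _ _ proper.1.factors_kernel_comp_desc)
      (Subobject.factorThru _ _ proper.2.factors_kernel_comp_desc)
  have graphs_commute : HuqCommute (graph x) (graph y) := by
    apply ssh_iff_reflects_kernel.1 h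
    rw [kernel_graph, kernel_graph]
    exact kernels_commute.postcomp _
  simpa [graph, R, CommuteOver] using
    ((huqCommute_iff_admissible_hom _ _).1 graphs_commute).postcomp prod.snd

lemma ssh_of_commuteOver
    (h : ∀ {X Y W D : C} (x : X ⟶ D) (y : Y ⟶ D) (w : W ⟶ D), IsWeightProper x y w →
      HuqCommute x y → CommuteOver x y w) : SSH C := by
  rw [ssh_iff_reflects_kernel]
  intro B P Q R α γ huq
  rw [huqCommute_iff_admissible_hom]
  apply admissible_of_commuteOver (by rw [α.σ_hom, γ.σ_hom])
  rw [α.σ_hom]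
  exact h _ _ _
    ⟨isWeightNormal_imageSubobject_kernel α, isWeightNormal_imageSubobject_kernel γ⟩ huq

theorem theorem3p8_general (C : Type u) [Category.{v} C] [HasZeroMorphisms C] [HasZeroObject C]
    [Regular C] [Protomodular C] [HasBinaryCoproducts C] :
    List.TFAE [
      SSH C,
      ∀ {X Y W D : C} (x : X ⟶ D) (y : Y ⟶ D) (w : W ⟶ D), IsWeightProper x y w →
        HuqCommute x y → CommuteOver x y w,
      ∀ {X Y D : C} (x : X ⟶ D) (y : Y ⟶ D) {W W' : C} (w : W ⟶ D) (w' : W' ⟶ D),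
        IsWeightProper x y w → IsWeightProper x y w' → (CommuteOver x y w ↔ CommuteOver x y w'),
      ∀ {X Y W D : C} (x : X ⟶ D) (y : Y ⟶ D) (w : W ⟶ D), IsWeightProper x y w →
        higginsCommutator (imageSubobject x).arrow (imageSubobject y).arrow = ⊥ →
        higginsCommutator₃ (imageSubobject x).arrow (imageSubobject y).arrow
          (imageSubobject w).arrow = ⊥] := by
  tfae_have 1 → 2 := fun ssh _ _ _ _ _ _ _ => commuteOver_of_ssh ssh
  tfae_have 2 → 1 := ssh_of_commuteOver
  tfae_have 2 → 3 := fun h _ _ _ x y _ _ w w' proper proper' =>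
    ⟨fun hw => h x y w' proper' (commuteOver_iff.1 hw).1,
      fun hw' => h x y w proper (commuteOver_iff.1 hw').1⟩
  tfae_have 3 → 2 := fun h _ _ W _ x y w proper huq =>
    (h x y (0 : W ⟶ _) w (isWeightProper_zero x y W) proper).1 (huq.commuteOver_zero W)
  tfae_have 2 → 4 := fun h _ _ _ _ x y w proper higgins_eq_bot =>
    (commuteOver_iff.1 <| h _ _ _ proper.image <|
      (huqCommute_iff_higginsCommutator_eq_bot _ _).2 higgins_eq_bot).2
  tfae_have 4 → 2 := by
    intro h X Y W D x y w proper huq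
    have images_commute : CommuteOver (imageSubobject x).arrow (imageSubobject y).arrow
        (imageSubobject w).arrow :=
      commuteOver_iff.2 ⟨huq.image, h x y w proper <|
        (huqCommute_iff_higginsCommutator_eq_bot _ _).1 huq.image⟩
    simpa using images_commute.precomp (factorThruImageSubobject x) (factorThruImageSubobject y)
      (factorThruImageSubobject w)
  tfae_finish

end WeightedCommutation

end SemiAb

end

open SemiAb in
theorem theorem3p8 (C : Type u) [Category.{v} C] [HasZeroMorphisms C] [SemiAbelian C] :
    List.TFAE [
      SSH C,
      ∀ {X Y W D : C} (x : X ⟶ D) (y : Y ⟶ D) (w : W ⟶ D), WProper x y w →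
        HuqCommute x y → CommuteOver x y w,
      ∀ {X Y D : C} (x : X ⟶ D) (y : Y ⟶ D) {W W' : C} (w : W ⟶ D) (w' : W' ⟶ D),
        WProper x y w → WProper x y w' → (CommuteOver x y w ↔ CommuteOver x y w'),
      ∀ {X Y W D : C} (x : X ⟶ D) (y : Y ⟶ D) (w : W ⟶ D), WProper x y w →
        higgins (imageSubobject x) (imageSubobject y) = ⊥ →
        higgins₃ (imageSubobject x) (imageSubobject y) (imageSubobject w) = ⊥] := by
  have : Protomodular C := ⟨SemiAbelian.protomodular⟩
  exact theorem3p8_general C
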